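/- **Theorem (MMD approximation).** There are absolute constants $c>0$ and $C>0$ such that the following holds. Let a discounted Markov decision process have state space $\mathcal S\subseteq\mathbb R^p$, action space $\mathcal A\subseteq\mathbb R^q$, transition probabilities $P(s'\mid s,a)$, a reward function, a discount factor $\gamma\in(0,1)$ and an initial state distribution, and put $d=p+q$. Let $\pi_1,\pi_2$ be two (possibly stochastic) Markov policies, with occupancy measures $\rho_i=(1-\gamma)\sum_{t\ge 0}\gamma^t\,\Pr[(S_t,A_t)\in\cdot\mid\pi_i]$, $i=1,2$. Let $\sigma>0$, let $k(x,y)=\exp\big(-\|x-y\|^2/(2\sigma^2)\big)$ be the Gaussian kernel on $\mathbb R^d$, let $\Phi$ be its canonical feature map into its reproducing kernel Hilbert space, and put $$\mathrm{MMD}(\rho_1,\rho_2)=\big\|\mathbb E_{(s,a)\sim\rho_1}\Phi([s;a])-\mathbb E_{(s,a)\sim\rho_2}\Phi([s;a])\big\|,$$ where $[s;a]\in\mathbb R^d$ is the concatenation of $s$ and $a$. Let $D,n\ge 1$, and let $w_1,\dots,w_D\sim\mathcal N(0,\sigma^{-2}I_d)$, $b_1,\dots,b_D\sim\mathcal U(0,2\pi)$,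 $x_1,\dots,x_n\sim\rho_1$ and $y_1,\dots,y_n\sim\rho_2$ be mutually independent. Define the random Fourier features $$\phi(s,a)=\sqrt{2/D}\,\big(\cos(w_1^{T}[s;a]+b_1),\dots,\cos(w_D^{T}[s;a]+b_D)\big)\in\mathbb R^D$$ and the policy embeddings $\phi_1=\frac1n\sum_{j=1}^n\phi(x_j)$ and $\phi_2=\frac1n\sum_{j=1}^n\phi(y_j)$. Then for every $\varepsilon>0$, $$\Pr\Big[\big|\,\|\phi_1-\phi_2\|_2-\mathrm{MMD}(\rho_1,\rho_2)\big|\ge\tfrac34\varepsilon\Big]\le 2e^{-nc\varepsilon^2}+\frac{C}{\varepsilon^2}\exp\Big(\frac{-D\varepsilon^2}{64(d+2)}\Big)+6e^{-n\varepsilon^2/8}.$$ -/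

import Mathlib

open MeasureTheory ProbabilityTheory
open scoped ENNReal

namespace AutoQD

/-! ### Markov decision processes and occupancy measures -/

/-- A discounted Markov decision process whose states and actions are real vectors: the state space
is a set `S ⊆ ℝ^p` and the action space a set `A ⊆ ℝ^q`, with their Borel σ-algebras. -/
structure MDP {p q : ℕ} (S : Set (EuclideanSpace ℝ (Fin p)))
    (A : Set (EuclideanSpace ℝ (Fin q))) where
  /-- distribution of the initial state -/
  init : Measure S
  isProbabilityMeasure_init : IsProbabilityMeasure init
  /-- transition probabilities `P(s' | s, a)` -/
  trans : Kernel (S × A) S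
  isMarkovKernel_trans : IsMarkovKernel trans
  /-- reward function -/
  reward : S × A → ℝ
  /-- discount factor -/
  γ : ℝ
  γ_pos : 0 < γ
  γ_lt_one : γ < 1

attribute [instance] MDP.isProbabilityMeasure_init MDP.isMarkovKernel_trans

section Occupancy

variable {p q : ℕ} {S : Set (EuclideanSpace ℝ (Fin p))} {A : Set (EuclideanSpace ℝ (Fin q))}

/-- The law of `(S_t, A_t)` when the policy `π` is followed: `S_0` has the initial distribution,
`A_t` is drawn from `π(· | S_t)` and `S_{t+1}` is drawn from `P(· | S_t, A_t)`. -/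
noncomputable def MDP.stateActionLaw (M : MDP S A) (π : Kernel S A) : ℕ → Measure (S × A)
  | 0 => M.init ⊗ₘ π
  | t + 1 => (M.trans ∘ₘ M.stateActionLaw π t) ⊗ₘ π

/-- The occupancy measure `ρ^π = (1 - γ) ∑_t γ^t P(S_t = ·, A_t = · | π)`. -/
noncomputable def MDP.occupancy (M : MDP S A) (π : Kernel S A) : Measure (S × A) :=
  ENNReal.ofReal (1 - M.γ) •
    Measure.sum (fun t : ℕ => ENNReal.ofReal (M.γ ^ t) • M.stateActionLaw π t)

instance (M : MDP S A) (π : Kernel S A) [IsMarkovKernel π] (t : ℕ) :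
    IsProbabilityMeasure (M.stateActionLaw π t) := by
  induction t with
  | zero => rw [MDP.stateActionLaw]; infer_instance
  | succ t ih => rw [MDP.stateActionLaw]; infer_instance

instance (M : MDP S A) (π : Kernel S A) [IsMarkovKernel π] :
    IsProbabilityMeasure (M.occupancy π) := by
  refine ⟨?_⟩
  have h1 : 0 < 1 - M.γ := sub_pos.2 M.γ_lt_one
  simp only [MDP.occupancy, Measure.smul_apply, smul_eq_mul,
    Measure.sum_apply _ MeasurableSet.univ, measure_univ, mul_one]
  rw [← ENNReal.ofReal_tsum_of_nonneg (fun t => pow_nonneg M.γ_pos.le t)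
      (summable_geometric_of_lt_one M.γ_pos.le M.γ_lt_one),
    tsum_geometric_of_lt_one M.γ_pos.le M.γ_lt_one, ← ENNReal.ofReal_mul h1.le,
    mul_inv_cancel₀ h1.ne', ENNReal.ofReal_one]

/-- The concatenation `[s; a] ∈ ℝ^(p+q)` of a state vector and an action vector. -/
def stateActionVec (z : S × A) : EuclideanSpace ℝ (Fin (p + q)) :=
  WithLp.toLp 2 (Fin.append (fun i => (z.1 : EuclideanSpace ℝ (Fin p)) i)
    (fun j => (z.2 : EuclideanSpace ℝ (Fin q)) j))

end Occupancy

/-! ### The Gaussian kernel and the maximum mean discrepancy -/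

/-- The Gaussian kernel `k(x, y) = exp(-‖x - y‖² / (2σ²))` of width `σ`. -/
noncomputable def gaussianKernel {d : ℕ} (σ : ℝ) (x y : EuclideanSpace ℝ (Fin d)) : ℝ :=
  Real.exp (-‖x - y‖ ^ 2 / (2 * σ ^ 2))

/-- The Gaussian kernel as a matrix of operators on `ℝ`, the form in which Mathlib constructs
the reproducing kernel Hilbert space of a kernel. -/
noncomputable def gaussianKernelMatrix (d : ℕ) (σ : ℝ) :
    Matrix (EuclideanSpace ℝ (Fin d)) (EuclideanSpace ℝ (Fin d)) (ℝ →L[ℝ] ℝ) :=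
  Matrix.of fun x y => gaussianKernel σ x y • ContinuousLinearMap.id ℝ ℝ

lemma gaussianKernel_eq_integral {d : ℕ} (σ : ℝ) (x y : EuclideanSpace ℝ (Fin d)) :
    gaussianKernel σ x y = ∫ w, Real.cos (inner ℝ w (σ⁻¹ • x) - inner ℝ w (σ⁻¹ • y))
      ∂(stdGaussian (EuclideanSpace ℝ (Fin d))) := by
  have h := congrArg Complex.re (charFun_stdGaussian (σ⁻¹ • x - σ⁻¹ • y))
  have hint : Integrable (fun w : EuclideanSpace ℝ (Fin d) =>
      Complex.exp (inner ℝ w (σ⁻¹ • x - σ⁻¹ • y) * Complex.I))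
      (stdGaussian (EuclideanSpace ℝ (Fin d))) := by
    refine Integrable.of_bound (by fun_prop) 1 (ae_of_all _ fun w => ?_)
    rw [Complex.norm_exp_ofReal_mul_I]
  rw [charFun_apply] at h
  have h2 := integral_re hint
  simp only [RCLike.re_to_complex] at h2
  rw [← h2] at h
  simp only [Complex.exp_ofReal_mul_I_re, inner_sub_right] at h
  rw [h, gaussianKernel, ← smul_sub, norm_smul, norm_inv, Real.norm_eq_abs]
  have h3 : (-((|σ|⁻¹ * ‖x - y‖ : ℝ) : ℂ) ^ 2 / 2) =
      ((-‖x - y‖ ^ 2 / (2 * σ ^ 2) : ℝ) : ℂ) := by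
    have h4 : -‖x - y‖ ^ 2 / (2 * σ ^ 2) = -(|σ|⁻¹ * ‖x - y‖) ^ 2 / 2 := by
      rw [mul_pow, inv_pow, sq_abs, mul_comm (2 : ℝ), ← div_div]
      ring
    rw [h4]
    push_cast
    ring
  rw [h3, Complex.exp_ofReal_re]

instance gaussianKernelMatrix_posSemidef (d : ℕ) (σ : ℝ) :
    Fact (gaussianKernelMatrix d σ).PosSemidef := by
  refine ⟨((RKHS.posSemidef_tfae (K := gaussianKernelMatrix d σ)).out 0 2 rfl rfl).2
    ⟨?_, fun v => ?_⟩⟩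
  · ext x y
    simp [gaussianKernelMatrix, gaussianKernel, norm_sub_rev x y, Matrix.conjTranspose_apply,
      ContinuousLinearMap.star_eq_adjoint, ContinuousLinearMap.adjoint_id]
  · have key : ∀ x y : EuclideanSpace ℝ (Fin d),
        Integrable (fun w => Real.cos (inner ℝ w (σ⁻¹ • x) - inner ℝ w (σ⁻¹ • y)))
          (stdGaussian (EuclideanSpace ℝ (Fin d))) := fun x y =>
      Integrable.of_bound (by fun_prop) 1 (ae_of_all _ fun w => Real.abs_cos_le_one _)
    have h : (v.sum fun x z => v.sum fun x' z' =>
          inner ℝ (gaussianKernelMatrix d σ x' x z) z') =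
        ∫ w, ((∑ x ∈ v.support, v x * Real.cos (inner ℝ w (σ⁻¹ • x))) ^ 2 +
          (∑ x ∈ v.support, v x * Real.sin (inner ℝ w (σ⁻¹ • x))) ^ 2)
          ∂(stdGaussian (EuclideanSpace ℝ (Fin d))) := by
      have h1 : (v.sum fun x z => v.sum fun x' z' =>
          inner ℝ (gaussianKernelMatrix d σ x' x z) z') =
          ∑ x ∈ v.support, ∑ x' ∈ v.support, (v x * v x') *
            ∫ w, Real.cos (inner ℝ w (σ⁻¹ • x') - inner ℝ w (σ⁻¹ • x))
              ∂(stdGaussian (EuclideanSpace ℝ (Fin d))) := by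
        simp only [Finsupp.sum, ← gaussianKernel_eq_integral]
        refine Finset.sum_congr rfl fun x _ => Finset.sum_congr rfl fun x' _ => ?_
        simp [gaussianKernelMatrix]
        ring
      rw [h1]
      simp_rw [← integral_const_mul]
      simp_rw [← integral_finsetSum _ (fun x' _ => (key x' _).const_mul _)]
      rw [← integral_finsetSum _
        (fun x _ => integrable_finsetSum _ (fun x' _ => (key x' x).const_mul _))]
      refine integral_congr_ae (ae_of_all _ fun w => ?_)
      simp only [sq, Finset.sum_mul_sum, ← Finset.sum_add_distrib, Real.cos_sub]
      refine Finset.sum_congr rfl fun x _ => Finset.sum_congr rfl fun x' _ => ?_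
      ring
    rw [h]
    exact integral_nonneg fun w => by positivity

/-- The canonical feature map `x ↦ k(x, ·)` into the reproducing kernel Hilbert space of the
Gaussian kernel. -/
noncomputable def gaussianFeature {d : ℕ} (σ : ℝ) (x : EuclideanSpace ℝ (Fin d)) :
    RKHS.OfKernel (gaussianKernelMatrix d σ) :=
  RKHS.kerFun (RKHS.OfKernel (gaussianKernelMatrix d σ)) x (1 : ℝ)

lemma inner_gaussianFeature {d : ℕ} (σ : ℝ) (x y : EuclideanSpace ℝ (Fin d)) :
    inner ℝ (gaussianFeature σ x) (gaussianFeature σ y) = gaussianKernel σ x y := by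
  rw [gaussianFeature, gaussianFeature, ← RKHS.kernel_inner, RKHS.OfKernel.kernel_ofKernel]
  simp [gaussianKernelMatrix, gaussianKernel, norm_sub_rev x y]

/-- The maximum mean discrepancy `MMD(P, Q) = ‖E_{X ∼ P} Φ(X) - E_{Y ∼ Q} Φ(Y)‖`, with `Φ` the
feature map of the Gaussian kernel. -/
noncomputable def MMD {d : ℕ} (σ : ℝ) (P Q : Measure (EuclideanSpace ℝ (Fin d))) : ℝ :=
  ‖(∫ x, gaussianFeature σ x ∂P) - ∫ y, gaussianFeature σ y ∂Q‖

/-! ### Random Fourier features and policy embeddings -/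

/-- The `D`-dimensional random Fourier features with frequencies `w_i` and offsets `b_i`:
`φ(x) = √(2/D) (cos(⟨w_1, x⟩ + b_1), …, cos(⟨w_D, x⟩ + b_D))`. -/
noncomputable def fourierFeatures {d D : ℕ} (w : Fin D → EuclideanSpace ℝ (Fin d))
    (b : Fin D → ℝ) (x : EuclideanSpace ℝ (Fin d)) : EuclideanSpace ℝ (Fin D) :=
  WithLp.toLp 2 fun i => √(2 / (D : ℝ)) * Real.cos (inner ℝ (w i) x + b i)

/-- The embedding of a sample `x_1, …, x_n`: the empirical mean of its random Fourier features. -/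
noncomputable def embedding {d D n : ℕ} (w : Fin D → EuclideanSpace ℝ (Fin d))
    (b : Fin D → ℝ) (x : Fin n → EuclideanSpace ℝ (Fin d)) : EuclideanSpace ℝ (Fin D) :=
  (1 / (n : ℝ)) • ∑ j, fourierFeatures w b (x j)

/-- The random draws: frequencies `w_i ∼ 𝒩(0, σ⁻² I)`, offsets `b_i ∼ 𝒰(0, 2π)`, samples
`x_j ∼ ρ₁` and `y_j ∼ ρ₂`, all of them mutually independent. -/
structure IsDraw {Ω 𝓩 : Type*} [MeasurableSpace Ω] [MeasurableSpace 𝓩] {d D n : ℕ} (μ : Measure Ω)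
    (σ : ℝ) (ρ₁ ρ₂ : Measure 𝓩) (w : Fin D → Ω → EuclideanSpace ℝ (Fin d)) (b : Fin D → Ω → ℝ)
    (x y : Fin n → Ω → 𝓩) : Prop where
  measurable_w : ∀ i, Measurable (w i)
  measurable_b : ∀ i, Measurable (b i)
  measurable_x : ∀ j, Measurable (x j)
  measurable_y : ∀ j, Measurable (y j)
  law_w : ∀ i, μ.map (w i) = multivariateGaussian 0 ((σ ^ 2)⁻¹ • (1 : Matrix (Fin d) (Fin d) ℝ))
  law_b : ∀ i, μ.map (b i) = ProbabilityTheory.cond volume (Set.Ioo 0 (2 * Real.pi))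
  law_x : ∀ j, μ.map (x j) = ρ₁
  law_y : ∀ j, μ.map (y j) = ρ₂
  indep : iIndep (Sum.elim
    (Sum.elim (fun i => MeasurableSpace.comap (w i) inferInstance)
      (fun i => MeasurableSpace.comap (b i) inferInstance))
    (Sum.elim (fun j => MeasurableSpace.comap (x j) inferInstance)
      (fun j => MeasurableSpace.comap (y j) inferInstance))) μ

end AutoQD

/-! For a frequency and offset θ, let F(θ) be √2 times the difference of the means of x ↦ cos(⟨w, x⟩
+ b) under the two laws P, Q on ℝ^d. The random Fourier identity says that k(x, y) is the θ-average
of products of cosine features, so Fubini gives MMD² = E F(θ)² (`MMD_sq`). Let U be the difference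
of the two embeddings, and let V be the vector with coordinates F(θ_i)/√D, that is, U with empirical
means replaced by true means. Then |‖U‖ - MMD| ≤ ‖U - V‖ + |‖V‖ - MMD|.

The second error depends only on the features. ‖V‖² is an average of i.i.d. variables in [0, 8] with
mean MMD². Their second moment is at most 8 times their mean, so a Chernoff bound controls the root
‖V‖ itself at scale δ, uniformly in the size of MMD (`measureReal_sqrt_average_ge_le`,
`measureReal_sqrt_average_le_le`).

The first error comes from sampling. ‖U - V‖² is the average of the squares of D errors that share
the same samples and so are not independent. Each is sub-Gaussian with proxy 4/n at a frozen
feature, hence has a bounded square-exponential moment, and Jensen's inequality passes this to the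
average without independence (`measureReal_average_sq_ge_le`).

The resulting bound is dimension-free and is then weakened to the stated form. -/

namespace ProbabilityTheory

/-! ### Independence of pairs; square-exponential moments. -/

lemma iIndep.iIndepFun_prodMk {ι Ω α β : Type*} [MeasurableSpace Ω] [MeasurableSpace α]
    [MeasurableSpace β] {μ : Measure Ω} {f : ι → Ω → α} {g : ι → Ω → β}
    (hf : ∀ i, Measurable (f i)) (hg : ∀ i, Measurable (g i))
    (h : iIndep (Sum.elim (fun i => MeasurableSpace.comap (f i) inferInstance)
      (fun i => MeasurableSpace.comap (g i) inferInstance)) μ) :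
    iIndepFun (fun i ω => (f i ω, g i ω)) μ := by
  classical
  rw [iIndepFun_iff_iIndep]
  -- Preimages of measurable rectangles form a π-system generating the σ-algebra of each pair, so
  -- independence need only be tested on them.
  refine iIndepSets.iIndep (fun i => ((hf i).prodMk (hg i)).comap_le)
    (fun i => {s | ∃ t ∈ Set.image2 (· ×ˢ ·) {a : Set α | MeasurableSet a}
      {b : Set β | MeasurableSet b}, (fun ω => (f i ω, g i ω)) ⁻¹' t = s})
    (fun i => isPiSystem_prod.comap _) (fun i => ?_) ?_
  · rw [← generateFrom_prod, MeasurableSpace.comap_generateFrom]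
    rfl
  · rw [iIndepSets_iff]
    intro S u hu
    have hu' : ∀ i, ∃ a b, MeasurableSet a ∧ MeasurableSet b ∧
        (i ∈ S → u i = f i ⁻¹' a ∩ g i ⁻¹' b) := by
      intro i
      by_cases hi : i ∈ S
      · obtain ⟨t, ⟨a, ha, b, hb, rfl⟩, h⟩ := hu i hi
        exact ⟨a, b, ha, hb, fun _ => h.symm⟩
      · exact ⟨∅, ∅, .empty, .empty, fun h => absurd h hi⟩
    choose a b ha hb hab using hu'
    rw [iIndep_iff] at h
    -- Stated for every T ⊆ S because it is used twice: for S itself, and for singletons to identify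
    -- each factor.
    have key : ∀ T ⊆ S, μ (⋂ i ∈ T, u i) =
        (∏ i ∈ T, μ (f i ⁻¹' a i)) * ∏ i ∈ T, μ (g i ⁻¹' b i) := by
      intro T hT
      have := h (T.disjSum T) (f := Sum.elim (fun i => f i ⁻¹' a i) (fun i => g i ⁻¹' b i)) (by
        rintro (i | i) -
        · exact ⟨a i, ha i, rfl⟩
        · exact ⟨b i, hb i, rfl⟩)
      rw [Finset.prod_disjSum] at this
      simp only [Sum.elim_inl, Sum.elim_inr] at this
      rw [← this]
      congr 1
      ext ω
      simp only [Set.mem_iInter, Finset.mem_disjSum, Sum.forall]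
      constructor
      · intro H
        refine ⟨fun i hi => ?_, fun i hi => ?_⟩
        · have hi' : i ∈ T := by simpa using hi
          have := H i hi'
          rw [hab i (hT hi')] at this
          exact this.1
        · have hi' : i ∈ T := by simpa using hi
          have := H i hi'
          rw [hab i (hT hi')] at this
          exact this.2
      · rintro ⟨H1, H2⟩ i hi
        rw [hab i (hT hi)]
        exact ⟨H1 i (by simpa using hi), H2 i (by simpa using hi)⟩
    rw [key S subset_rfl, ← Finset.prod_mul_distrib]
    refine Finset.prod_congr rfl fun i hi => ?_
    simpa using (key {i} (by simpa using hi)).symm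

/-- Sub-Gaussian variables have square-exponential moments. -/
lemma HasSubgaussianMGF.lintegral_exp_sq_le {Ω : Type*} [MeasurableSpace Ω] {μ : Measure Ω}
    [IsProbabilityMeasure μ] {X : Ω → ℝ} {c : NNReal} (hX : HasSubgaussianMGF X c μ)
    {κ : ℝ} (hκ : 0 ≤ κ) (hκc : κ * c ≤ 1 / 4) :
    ∫⁻ ω, ENNReal.ofReal (Real.exp (κ * X ω ^ 2)) ∂μ ≤ 2 := by
  -- Linearise the square: exp(κz²) = E exp(s g z) for a standard normal g. After Tonelli, the
  -- sub-Gaussian bound in X gives exp(κ c g²) ≤ exp(g²/4), whose Gaussian mean is √2.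
  set s := √(2 * κ) with hs
  have hs2 : s ^ 2 = 2 * κ := Real.sq_sqrt (by positivity)
  have h1 : ∀ z : ℝ, ENNReal.ofReal (Real.exp (κ * z ^ 2)) =
      ∫⁻ g, ENNReal.ofReal (Real.exp (s * g * z)) ∂(gaussianReal 0 1) := by
    intro z
    have := mgf_gaussianReal (p := gaussianReal 0 1) (X := id) (μ := 0) (v := 1) (by simp) (s * z)
    rw [← ofReal_integral_eq_lintegral_ofReal]
    · congr 1
      rw [mgf] at this
      simp only [id] at this
      rw [show κ * z ^ 2 = 0 * (s * z) + ((1 : NNReal) : ℝ) * (s * z) ^ 2 / 2 by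
        rw [mul_pow, hs2]; push_cast; ring, ← this]
      congr with g
      ring_nf
    · have := integrable_exp_mul_gaussianReal (μ := 0) (v := 1) (s * z)
      refine this.congr (ae_of_all _ fun g => ?_)
      ring_nf
    · exact ae_of_all _ fun g => (Real.exp_pos _).le
  have hXm := hX.aemeasurable
  calc ∫⁻ ω, ENNReal.ofReal (Real.exp (κ * X ω ^ 2)) ∂μ
      = ∫⁻ ω, ∫⁻ g, ENNReal.ofReal (Real.exp (s * g * X ω)) ∂(gaussianReal 0 1) ∂μ := by
        simp_rw [h1]
    _ = ∫⁻ g, ∫⁻ ω, ENNReal.ofReal (Real.exp (s * g * X ω)) ∂μ ∂(gaussianReal 0 1) := by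
        refine lintegral_lintegral_swap ?_
        have : AEMeasurable (fun p : Ω × ℝ => X p.1) (μ.prod (gaussianReal 0 1)) :=
          hXm.comp_fst
        have h2 : AEMeasurable (fun p : Ω × ℝ => s * p.2 * X p.1) (μ.prod (gaussianReal 0 1)) :=
          AEMeasurable.mul (by fun_prop) this
        exact (Real.measurable_exp.comp_aemeasurable h2).ennreal_ofReal
    _ ≤ ∫⁻ g, ENNReal.ofReal (Real.exp (g ^ 2 / 4)) ∂(gaussianReal 0 1) := by
        refine lintegral_mono fun g => ?_
        rw [← ofReal_integral_eq_lintegral_ofReal (hX.integrable_exp_mul _)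
          (ae_of_all _ fun g => (Real.exp_pos _).le)]
        refine ENNReal.ofReal_le_ofReal ((hX.mgf_le (s * g)).trans (Real.exp_le_exp.2 ?_))
        rw [mul_pow, hs2]
        nlinarith [sq_nonneg g]
    _ = ENNReal.ofReal (√2) := by
        rw [gaussianReal_of_var_ne_zero _ one_ne_zero,
          lintegral_withDensity_eq_lintegral_mul _ (measurable_gaussianPDF _ _) (by fun_prop)]
        have : ∀ g : ℝ, (gaussianPDF 0 1 * fun g => ENNReal.ofReal (Real.exp (g ^ 2 / 4))) g =
            ENNReal.ofReal ((√(2 * Real.pi))⁻¹ * Real.exp (-(1 / 4) * g ^ 2)) := by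
          intro g
          simp only [Pi.mul_apply, gaussianPDF, gaussianPDFReal]
          rw [← ENNReal.ofReal_mul (by positivity), mul_assoc, ← Real.exp_add]
          congr 3
          · simp
          · push_cast; ring
        simp_rw [this]
        rw [← ofReal_integral_eq_lintegral_ofReal, integral_const_mul, integral_gaussian]
        · congr 1
          rw [← Real.sqrt_inv, ← Real.sqrt_mul (by positivity)]
          congr 1
          field_simp
          norm_num
        · exact (integrable_exp_neg_mul_sq (by norm_num)).const_mul _
        · exact ae_of_all _ fun g => by positivity
    _ ≤ 2 := by
        rw [← ENNReal.ofReal_ofNat]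
        exact ENNReal.ofReal_le_ofReal ((Real.sqrt_le_left (by norm_num)).2 (by norm_num))

end ProbabilityTheory

namespace AutoQD

/-! ### MMD as the mean square of a random feature gap. -/

lemma norm_gaussianFeature {d : ℕ} (σ : ℝ) (x : EuclideanSpace ℝ (Fin d)) :
    ‖gaussianFeature σ x‖ = 1 := by
  have h := inner_gaussianFeature σ x x
  rw [real_inner_self_eq_norm_sq] at h
  have h1 : ‖gaussianFeature σ x‖ ^ 2 = 1 := by simpa [gaussianKernel] using h
  exact (pow_eq_one_iff_of_nonneg (norm_nonneg _) two_ne_zero).1 h1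

/-- ‖Φ(y) - Φ(x)‖² = 2 - 2k(y, x), so continuity is inherited from the kernel. It supplies the
measurability that the Bochner integrals in the MMD require. -/
lemma continuous_gaussianFeature {d : ℕ} (σ : ℝ) :
    Continuous (gaussianFeature σ : EuclideanSpace ℝ (Fin d) → _) := by
  refine continuous_iff_continuousAt.2 fun x => ?_
  rw [ContinuousAt, tendsto_iff_norm_sub_tendsto_zero]
  have h : ∀ y : EuclideanSpace ℝ (Fin d), ‖gaussianFeature σ y - gaussianFeature σ x‖ =
      √(2 - 2 * gaussianKernel σ y x) := by
    intro y
    rw [← Real.sqrt_sq (norm_nonneg (gaussianFeature σ y - gaussianFeature σ x)), norm_sub_sq_real,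
      norm_gaussianFeature, norm_gaussianFeature, inner_gaussianFeature]
    ring_nf
  simp_rw [h]
  have hc : Continuous fun y : EuclideanSpace ℝ (Fin d) => √(2 - 2 * gaussianKernel σ y x) := by
    unfold gaussianKernel
    fun_prop
  simpa [gaussianKernel] using hc.tendsto x

lemma integrable_gaussianFeature {d : ℕ} (σ : ℝ) (P : Measure (EuclideanSpace ℝ (Fin d)))
    [IsFiniteMeasure P] : Integrable (gaussianFeature σ) P :=
  Integrable.of_bound (continuous_gaussianFeature σ).aestronglyMeasurable 1
    (ae_of_all _ fun x => (norm_gaussianFeature σ x).le)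

/-- The uniform distribution on `(0, 2π)`. -/
noncomputable abbrev uniformAngle : Measure ℝ :=
  ProbabilityTheory.cond volume (Set.Ioo 0 (2 * Real.pi))

instance : IsProbabilityMeasure uniformAngle :=
  cond_isProbabilityMeasure_of_finite (by simp [Real.pi_pos])
    (by rw [Real.volume_Ioo]; exact ENNReal.ofReal_ne_top)

/-- The joint law of a frequency and an offset of the random Fourier features. -/
noncomputable def featureLaw (d : ℕ) (σ : ℝ) : Measure (EuclideanSpace ℝ (Fin d) × ℝ) :=
  (multivariateGaussian 0 ((σ ^ 2)⁻¹ • (1 : Matrix (Fin d) (Fin d) ℝ))).prod uniformAngle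

instance (d : ℕ) (σ : ℝ) : IsProbabilityMeasure (featureLaw d σ) := by
  unfold featureLaw; infer_instance

/-- Product-to-sum leaves cos(a - c) plus cos(2b + a + c), and the latter averages to zero over two
full periods. This is why the offsets are uniform and the features carry a factor √2. -/
lemma integral_two_mul_cos_mul_cos (a c : ℝ) :
    ∫ b, 2 * (Real.cos (a + b) * Real.cos (c + b)) ∂uniformAngle = Real.cos (a - c) := by
  have h2 : ∀ b, 2 * (Real.cos (a + b) * Real.cos (c + b)) =
      Real.cos (a - c) + Real.cos (2 * b + (a + c)) := by
    intro b
    rw [show a - c = (a + b) - (c + b) by ring, show 2 * b + (a + c) = (a + b) + (c + b) by ring,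
      Real.cos_sub, Real.cos_add (a + b)]
    ring
  have h3 : ∫ b, Real.cos (2 * b + (a + c)) ∂uniformAngle = 0 := by
    rw [uniformAngle, ProbabilityTheory.cond, integral_smul_measure, ← integral_Ioc_eq_integral_Ioo,
      ← intervalIntegral.integral_of_le (by positivity)]
    rw [intervalIntegral.integral_comp_mul_add (fun y => Real.cos y) two_ne_zero, integral_cos]
    rw [show 2 * (2 * Real.pi) + (a + c) = (a + c) + 2 * Real.pi + 2 * Real.pi by ring]
    simp
  simp_rw [h2]
  rw [integral_add (integrable_const _)
    (Integrable.of_bound (by fun_prop) 1 (ae_of_all _ fun b => Real.abs_cos_le_one _)), h3]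
  simp

lemma integral_cos_inner_multivariateGaussian {d : ℕ} (σ : ℝ) (x y : EuclideanSpace ℝ (Fin d)) :
    ∫ w, Real.cos (inner ℝ w x - inner ℝ w y)
      ∂(multivariateGaussian 0 ((σ ^ 2)⁻¹ • (1 : Matrix (Fin d) (Fin d) ℝ))) =
      gaussianKernel σ x y := by
  have hS : ((σ ^ 2)⁻¹ • (1 : Matrix (Fin d) (Fin d) ℝ)).PosSemidef :=
    Matrix.PosSemidef.one.smul (by positivity)
  have h := congrArg Complex.re (charFun_multivariateGaussian (μ := 0) hS (x - y))
  rw [charFun_apply] at h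
  have hint : Integrable (fun w : EuclideanSpace ℝ (Fin d) =>
      Complex.exp (inner ℝ w (x - y) * Complex.I))
      (multivariateGaussian 0 ((σ ^ 2)⁻¹ • (1 : Matrix (Fin d) (Fin d) ℝ))) := by
    refine Integrable.of_bound (by fun_prop) 1 (ae_of_all _ fun w => ?_)
    rw [Complex.norm_exp_ofReal_mul_I]
  have h2 := integral_re hint
  simp only [RCLike.re_to_complex] at h2
  rw [← h2] at h
  simp only [Complex.exp_ofReal_mul_I_re, inner_sub_right] at h
  rw [h, gaussianKernel, EuclideanSpace.real_norm_sq_eq]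
  have h3 : ∀ z : EuclideanSpace ℝ (Fin d),
      z.ofLp ⬝ᵥ ((σ ^ 2)⁻¹ • (1 : Matrix (Fin d) (Fin d) ℝ)).mulVec z.ofLp =
      (σ ^ 2)⁻¹ * ∑ i, z i ^ 2 := by
    intro z
    rw [Matrix.smul_mulVec, dotProduct_smul, Matrix.one_mulVec, dotProduct, smul_eq_mul]
    simp only [sq]
  rw [h3, inner_zero_right, ← Complex.exp_ofReal_re]
  congr 2
  simp only [PiLp.sub_apply]
  push_cast
  ring

lemma integral_feature_mul_feature {d : ℕ} (σ : ℝ) (x y : EuclideanSpace ℝ (Fin d)) :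
    ∫ θ, 2 * (Real.cos (inner ℝ θ.1 x + θ.2) * Real.cos (inner ℝ θ.1 y + θ.2))
      ∂(featureLaw d σ) = gaussianKernel σ x y := by
  rw [featureLaw, integral_prod]
  · simp_rw [integral_two_mul_cos_mul_cos]
    exact integral_cos_inner_multivariateGaussian σ x y
  · refine Integrable.of_bound (by fun_prop) 2 (ae_of_all _ fun θ => ?_)
    rw [Real.norm_eq_abs, abs_mul, abs_mul, abs_two]
    have h1 := Real.abs_cos_le_one (inner ℝ θ.1 x + θ.2)
    have h2 := Real.abs_cos_le_one (inner ℝ θ.1 y + θ.2)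
    have := mul_le_one₀ h1 (abs_nonneg _) h2
    linarith

/-- The mean under `P` of the cosine feature with frequency `θ.1` and offset `θ.2`. -/
noncomputable def meanFeature {d : ℕ} (P : Measure (EuclideanSpace ℝ (Fin d)))
    (θ : EuclideanSpace ℝ (Fin d) × ℝ) : ℝ :=
  ∫ x, Real.cos (inner ℝ θ.1 x + θ.2) ∂P

lemma measurable_meanFeature {d : ℕ} (P : Measure (EuclideanSpace ℝ (Fin d))) [SFinite P] :
    Measurable (meanFeature P) := by
  have : StronglyMeasurable (Function.uncurry fun (θ : EuclideanSpace ℝ (Fin d) × ℝ)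
      (x : EuclideanSpace ℝ (Fin d)) => Real.cos (inner ℝ θ.1 x + θ.2)) :=
    Continuous.stronglyMeasurable (by unfold Function.uncurry; fun_prop)
  exact this.integral_prod_right.measurable

lemma abs_meanFeature_le {d : ℕ} (P : Measure (EuclideanSpace ℝ (Fin d))) [IsProbabilityMeasure P]
    (θ : EuclideanSpace ℝ (Fin d) × ℝ) : |meanFeature P θ| ≤ 1 := by
  have := norm_integral_le_of_norm_le_const (μ := P) (C := 1)
    (f := fun x => Real.cos (inner ℝ θ.1 x + θ.2)) (ae_of_all _ fun x => Real.abs_cos_le_one _)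
  simpa [meanFeature] using this

/-- Both sides equal the integral of the kernel over P ⊗ Q: on the left the inner product moves
inside the Bochner integrals, on the right Fubini integrates out the feature first. -/
lemma inner_integral_gaussianFeature {d : ℕ} (σ : ℝ)
    (P Q : Measure (EuclideanSpace ℝ (Fin d))) [IsProbabilityMeasure P] [IsProbabilityMeasure Q] :
    inner ℝ (∫ x, gaussianFeature σ x ∂P) (∫ y, gaussianFeature σ y ∂Q) =
      ∫ θ, 2 * (meanFeature P θ * meanFeature Q θ) ∂(featureLaw d σ) := by
  have hb : Integrable (Function.uncurry fun (θ : EuclideanSpace ℝ (Fin d) × ℝ)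
      (z : EuclideanSpace ℝ (Fin d) × EuclideanSpace ℝ (Fin d)) =>
      2 * (Real.cos (inner ℝ θ.1 z.1 + θ.2) * Real.cos (inner ℝ θ.1 z.2 + θ.2)))
      ((featureLaw d σ).prod (P.prod Q)) := by
    refine Integrable.of_bound (Continuous.aestronglyMeasurable
      (by unfold Function.uncurry; fun_prop)) 2 (ae_of_all _ fun ⟨θ, z⟩ => ?_)
    rw [Function.uncurry, Real.norm_eq_abs, abs_mul, abs_mul, abs_two]
    have h1 := Real.abs_cos_le_one (inner ℝ θ.1 z.1 + θ.2)
    have h2 := Real.abs_cos_le_one (inner ℝ θ.1 z.2 + θ.2)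
    have := mul_le_one₀ h1 (abs_nonneg _) h2
    linarith
  have hR : ∀ θ, 2 * (meanFeature P θ * meanFeature Q θ) = ∫ z, 2 * (Real.cos (inner ℝ θ.1 z.1 + θ.2)
      * Real.cos (inner ℝ θ.1 z.2 + θ.2)) ∂(P.prod Q) := by
    intro θ
    rw [integral_const_mul, integral_prod_mul (fun x => Real.cos (inner ℝ θ.1 x + θ.2))
      (fun x => Real.cos (inner ℝ θ.1 x + θ.2))]
    rfl
  simp_rw [hR]
  rw [integral_integral_swap hb]
  simp_rw [integral_feature_mul_feature]
  rw [integral_prod]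
  · rw [real_inner_comm, ← integral_inner (integrable_gaussianFeature σ P)]
    congr with x
    rw [real_inner_comm, ← integral_inner (integrable_gaussianFeature σ Q)]
    congr with y
    exact inner_gaussianFeature σ x y
  · refine Integrable.of_bound (by unfold gaussianKernel; fun_prop) 1 (ae_of_all _ fun z => ?_)
    rw [gaussianKernel, Real.norm_eq_abs, abs_of_pos (Real.exp_pos _), Real.exp_le_one_iff]
    rw [neg_div]
    exact neg_nonpos.2 (by positivity)

/-- The gap between `P` and `Q` seen through a single random Fourier feature. -/
noncomputable def featureGap {d : ℕ} (P Q : Measure (EuclideanSpace ℝ (Fin d)))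
    (θ : EuclideanSpace ℝ (Fin d) × ℝ) : ℝ :=
  √2 * (meanFeature P θ - meanFeature Q θ)

lemma measurable_featureGap {d : ℕ} (P Q : Measure (EuclideanSpace ℝ (Fin d))) [SFinite P]
    [SFinite Q] : Measurable (featureGap P Q) :=
  ((measurable_meanFeature P).sub (measurable_meanFeature Q)).const_mul _

lemma featureGap_sq_le {d : ℕ} (P Q : Measure (EuclideanSpace ℝ (Fin d)))
    [IsProbabilityMeasure P] [IsProbabilityMeasure Q] (θ : EuclideanSpace ℝ (Fin d) × ℝ) :
    featureGap P Q θ ^ 2 ≤ 8 := by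
  have h1 := abs_le.1 (abs_meanFeature_le P θ)
  have h2 := abs_le.1 (abs_meanFeature_le Q θ)
  rw [featureGap, mul_pow, Real.sq_sqrt (by norm_num)]
  nlinarith

/-- The squared maximum mean discrepancy is the mean square of the random feature gap. -/
lemma MMD_sq {d : ℕ} (σ : ℝ) (P Q : Measure (EuclideanSpace ℝ (Fin d)))
    [IsProbabilityMeasure P] [IsProbabilityMeasure Q] :
    MMD σ P Q ^ 2 = ∫ θ, featureGap P Q θ ^ 2 ∂(featureLaw d σ) := by
  have hint : ∀ (P Q : Measure (EuclideanSpace ℝ (Fin d))) [IsProbabilityMeasure P]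
      [IsProbabilityMeasure Q],
      Integrable (fun θ => 2 * (meanFeature P θ * meanFeature Q θ)) (featureLaw d σ) := by
    intro P Q _ _
    refine Integrable.of_bound (((measurable_meanFeature P).mul
      (measurable_meanFeature Q)).const_mul 2).aestronglyMeasurable 2 (ae_of_all _ fun θ => ?_)
    rw [Real.norm_eq_abs, abs_mul, abs_mul, abs_two]
    have := mul_le_one₀ (abs_meanFeature_le P θ) (abs_nonneg _) (abs_meanFeature_le Q θ)
    linarith
  rw [MMD, norm_sub_sq_real, ← real_inner_self_eq_norm_sq, ← real_inner_self_eq_norm_sq,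
    inner_integral_gaussianFeature, inner_integral_gaussianFeature, inner_integral_gaussianFeature,
    ← integral_const_mul, ← integral_sub (hint P P) ((hint P Q).const_mul 2),
    ← integral_add (μ := featureLaw d σ) (f := fun θ => 2 * (meanFeature P θ * meanFeature P θ) -
      2 * (2 * (meanFeature P θ * meanFeature Q θ)))
      ((hint P P).sub ((hint P Q).const_mul 2)) (hint Q Q)]
  refine integral_congr_ae (ae_of_all _ fun θ => ?_)
  simp only [featureGap, mul_pow, Real.sq_sqrt (zero_le_two : (0 : ℝ) ≤ 2)]
  ring

/-! ### Concentration inequalities. -/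

/-- Tail of the quadratic mean of variables with square-exponential moments. -/
lemma measureReal_average_sq_ge_le {Ω : Type*} [MeasurableSpace Ω] {μ : Measure Ω}
    {D : ℕ} {G : Fin D → Ω → ℝ} (hD : 0 < D)
    (hG : ∀ i, Measurable (G i)) {κ : ℝ}
    (h : ∀ i, ∫⁻ ω, ENNReal.ofReal (Real.exp (κ * G i ω ^ 2)) ∂μ ≤ 2) {t : ℝ} (hκ : 0 ≤ κ) :
    μ.real {ω | t ≤ (D : ℝ)⁻¹ * ∑ i, G i ω ^ 2} ≤ 2 * Real.exp (-(κ * t)) := by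
  have hD' : (0 : ℝ) < D := by exact_mod_cast hD
  have hm : Measurable fun ω => ∑ i, ENNReal.ofReal ((D : ℝ)⁻¹) *
      ENNReal.ofReal (Real.exp (κ * G i ω ^ 2)) := by fun_prop
  have hsub : {ω | t ≤ (D : ℝ)⁻¹ * ∑ i, G i ω ^ 2} ⊆ {ω | ENNReal.ofReal (Real.exp (κ * t)) ≤
      ∑ i, ENNReal.ofReal ((D : ℝ)⁻¹) * ENNReal.ofReal (Real.exp (κ * G i ω ^ 2))} := by
    intro ω hω
    simp only [Set.mem_ofPred_eq] at hω ⊢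
    simp_rw [← ENNReal.ofReal_mul (inv_nonneg.2 hD'.le)]
    rw [← ENNReal.ofReal_sum_of_nonneg fun i _ => by positivity]
    refine ENNReal.ofReal_le_ofReal ?_
    -- Convexity of exp bounds the exponential of the average by the average of the exponentials, so
    -- no independence between the `G i` is needed before Markov's inequality.
    have hJ := convexOn_exp.map_sum_le (t := Finset.univ) (w := fun _ : Fin D => (D : ℝ)⁻¹)
      (p := fun i => κ * G i ω ^ 2) (fun i _ => inv_nonneg.2 hD'.le)
      (by simp [hD'.ne']) (fun i _ => Set.mem_univ _)
    simp only [smul_eq_mul] at hJ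
    refine le_trans (Real.exp_le_exp.2 ?_) hJ
    rw [← Finset.mul_sum, ← Finset.mul_sum, mul_left_comm]
    gcongr
  have hM := mul_meas_ge_le_lintegral (μ := μ) hm (ENNReal.ofReal (Real.exp (κ * t)))
  have hI : ∫⁻ ω, ∑ i, ENNReal.ofReal ((D : ℝ)⁻¹) *
      ENNReal.ofReal (Real.exp (κ * G i ω ^ 2)) ∂μ ≤ 2 := by
    rw [lintegral_finsetSum _ fun i _ => by fun_prop]
    calc ∑ i, ∫⁻ ω, ENNReal.ofReal ((D : ℝ)⁻¹) * ENNReal.ofReal (Real.exp (κ * G i ω ^ 2)) ∂μ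
        ≤ ∑ _i : Fin D, ENNReal.ofReal ((D : ℝ)⁻¹) * 2 := by
          refine Finset.sum_le_sum fun i _ => ?_
          rw [lintegral_const_mul _ (by fun_prop)]
          gcongr
          exact h i
      _ = 2 := by
          rw [Finset.sum_const, Finset.card_univ, Fintype.card_fin, nsmul_eq_mul, ← mul_assoc,
            ENNReal.ofReal_inv_of_pos hD', ENNReal.ofReal_natCast, ENNReal.mul_inv_cancel
              (by exact_mod_cast hD.ne') (by simp), one_mul]
  have hfin : ENNReal.ofReal (Real.exp (κ * t)) * μ {ω | t ≤ (D : ℝ)⁻¹ * ∑ i, G i ω ^ 2} ≤ 2 :=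
    (mul_le_mul_right (measure_mono hsub) _).trans (hM.trans hI)
  have := ENNReal.toReal_mono (by simp) hfin
  rw [ENNReal.toReal_mul, ENNReal.toReal_ofReal (Real.exp_pos _).le, ENNReal.toReal_ofNat] at this
  rw [Real.exp_neg, ← div_eq_mul_inv, le_div_iff₀' (Real.exp_pos _)]
  exact this

section Concentration

variable {Ω : Type*} [MeasurableSpace Ω] {μ : Measure Ω} [IsProbabilityMeasure μ]

/-- Combine exp(u) ≤ 1 + u + u² for |u| ≤ 1 with Z² ≤ 8Z. The quadratic term is then also
proportional to the mean, which is what later yields a tail for the root free of the size of the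
mean. -/
lemma mgf_le_of_mem_Icc_zero_eight {Z : Ω → ℝ} (hZ : Measurable Z) (h0 : ∀ ω, 0 ≤ Z ω)
    (h8 : ∀ ω, Z ω ≤ 8) {s : ℝ} (hs : |s| ≤ 1 / 8) :
    mgf Z μ s ≤ Real.exp ((∫ ω, Z ω ∂μ) * (s + 8 * s ^ 2)) := by
  have hint : Integrable Z μ := Integrable.of_mem_Icc 0 8 hZ.aemeasurable
    (ae_of_all _ fun ω => ⟨h0 ω, h8 ω⟩)
  calc mgf Z μ s ≤ ∫ ω, (1 + Z ω * (s + 8 * s ^ 2)) ∂μ := by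
        refine integral_mono (integrable_exp_mul_of_mem_Icc hZ.aemeasurable
          (ae_of_all _ fun ω => ⟨h0 ω, h8 ω⟩)) ((integrable_const _).add (hint.mul_const _))
          fun ω => ?_
        have h1 : |s * Z ω| ≤ 1 := by
          rw [abs_mul, abs_of_nonneg (h0 ω)]
          nlinarith [h0 ω, h8 ω, abs_nonneg s]
        have h2 := (abs_le.1 (Real.abs_exp_sub_one_sub_id_le h1)).2
        have h3 : (s * Z ω) ^ 2 ≤ 8 * s ^ 2 * Z ω := by
          nlinarith [mul_nonneg (mul_nonneg (sq_nonneg s) (h0 ω)) (sub_nonneg.2 (h8 ω))]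
        dsimp only
        nlinarith
    _ = (∫ ω, Z ω ∂μ) * (s + 8 * s ^ 2) + 1 := by
        rw [integral_add (integrable_const _) (hint.mul_const _), integral_mul_const]
        simp [add_comm]
    _ ≤ _ := Real.add_one_le_exp _

variable {D : ℕ} {Z : Fin D → Ω → ℝ}

lemma mgf_sum_le_of_mem_Icc_zero_eight (hind : iIndepFun Z μ) (hZ : ∀ i, Measurable (Z i))
    (h0 : ∀ i ω, 0 ≤ Z i ω) (h8 : ∀ i ω, Z i ω ≤ 8) {m : ℝ} (hm : ∀ i, ∫ ω, Z i ω ∂μ = m)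
    {s : ℝ} (hs : |s| ≤ 1 / 8) :
    mgf (∑ i, Z i) μ s ≤ Real.exp (D * (m * (s + 8 * s ^ 2))) := by
  rw [hind.mgf_sum hZ, Real.exp_nat_mul]
  calc ∏ i, mgf (Z i) μ s ≤ ∏ _i : Fin D, Real.exp (m * (s + 8 * s ^ 2)) :=
        Finset.prod_le_prod (fun i _ => mgf_nonneg) fun i _ => by
          have := mgf_le_of_mem_Icc_zero_eight (μ := μ) (hZ i) (h0 i) (h8 i) hs
          rwa [hm i] at this
    _ = _ := by simp

lemma integrable_exp_mul_sum_of_mem_Icc_zero_eight (hZ : ∀ i, Measurable (Z i))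
    (h0 : ∀ i ω, 0 ≤ Z i ω) (h8 : ∀ i ω, Z i ω ≤ 8) (s : ℝ) :
    Integrable (fun ω => Real.exp (s * (∑ i, Z i) ω)) μ := by
  refine integrable_exp_mul_of_mem_Icc (a := 0) (b := D * 8)
    (by rw [Finset.sum_fn]; exact (Finset.measurable_sum _ fun i _ => hZ i).aemeasurable) (ae_of_all _ fun ω => ?_)
  rw [Finset.sum_apply]
  refine ⟨Finset.sum_nonneg fun i _ => h0 i ω, ?_⟩
  simpa using Finset.sum_le_sum fun i (_ : i ∈ Finset.univ) => h8 i ω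

/-- Upper tail of the root of an average of independent variables with values in `[0, 8]`. -/
lemma measureReal_sqrt_average_ge_le (hD : 0 < D) (hind : iIndepFun Z μ)
    (hZ : ∀ i, Measurable (Z i)) (h0 : ∀ i ω, 0 ≤ Z i ω) (h8 : ∀ i ω, Z i ω ≤ 8) {r : ℝ}
    (hr : 0 ≤ r) (hm : ∀ i, ∫ ω, Z i ω ∂μ = r ^ 2) {δ : ℝ} (hδ : 0 < δ) :
    μ.real {ω | r + δ ≤ √((D : ℝ)⁻¹ * ∑ i, Z i ω)} ≤ Real.exp (-(D * δ ^ 2 / 32)) := by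
  have hD' : (0 : ℝ) < D := by exact_mod_cast hD
  -- The exponent gain is s(2rδ + δ²) - 8s²r². For r ≥ δ take s = δ/(8r); for r ≤ δ the cap s = 1/8
  -- suffices. Both give at least δ²/8; 1/32 is kept to match the lower tail.
  obtain ⟨s, hs0, hs8, hs⟩ : ∃ s : ℝ, 0 ≤ s ∧ s ≤ 1 / 8 ∧
      δ ^ 2 / 32 ≤ s * (r + δ) ^ 2 - r ^ 2 * (s + 8 * s ^ 2) := by
    rcases le_total r δ with h | h
    · exact ⟨1 / 8, by norm_num, le_rfl, by nlinarith [mul_nonneg hr hδ.le]⟩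
    · have hr0 : 0 < r := hδ.trans_le h
      refine ⟨δ / (8 * r), by positivity, ?_, ?_⟩
      · rw [div_le_div_iff₀ (by positivity) (by norm_num)]
        linarith
      · have : δ / (8 * r) * (r + δ) ^ 2 - r ^ 2 * (δ / (8 * r) + 8 * (δ / (8 * r)) ^ 2) =
            δ ^ 2 / 8 + δ ^ 3 / (8 * r) := by
          field_simp
          ring
        rw [this]
        have : 0 < δ ^ 3 / (8 * r) := by positivity
        nlinarith [sq_nonneg δ]
  calc μ.real {ω | r + δ ≤ √((D : ℝ)⁻¹ * ∑ i, Z i ω)}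
      ≤ μ.real {ω | D * (r + δ) ^ 2 ≤ (∑ i, Z i) ω} := by
        refine measureReal_mono fun ω hω => ?_
        simp only [Set.mem_ofPred_eq, Finset.sum_apply] at hω ⊢
        have := (Real.le_sqrt' (by positivity)).1 hω
        rwa [← div_eq_inv_mul, le_div_iff₀' hD'] at this
    _ ≤ Real.exp (-s * (D * (r + δ) ^ 2)) * mgf (∑ i, Z i) μ s :=
        measure_ge_le_exp_mul_mgf _ hs0 (integrable_exp_mul_sum_of_mem_Icc_zero_eight hZ h0 h8 s)
    _ ≤ Real.exp (-s * (D * (r + δ) ^ 2)) * Real.exp (D * (r ^ 2 * (s + 8 * s ^ 2))) := by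
        gcongr
        exact mgf_sum_le_of_mem_Icc_zero_eight hind hZ h0 h8 hm (by rwa [abs_of_nonneg hs0])
    _ ≤ _ := by
        rw [← Real.exp_add, Real.exp_le_exp]
        nlinarith

/-- Lower tail of the root of an average of independent variables with values in `[0, 8]`. -/
lemma measureReal_sqrt_average_le_le (hD : 0 < D) (hind : iIndepFun Z μ)
    (hZ : ∀ i, Measurable (Z i)) (h0 : ∀ i ω, 0 ≤ Z i ω) (h8 : ∀ i ω, Z i ω ≤ 8) {r : ℝ}
    (hm : ∀ i, ∫ ω, Z i ω ∂μ = r ^ 2) {δ : ℝ} (hδ : 0 < δ) :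
    μ.real {ω | √((D : ℝ)⁻¹ * ∑ i, Z i ω) ≤ r - δ} ≤ Real.exp (-(D * δ ^ 2 / 32)) := by
  have hD' : (0 : ℝ) < D := by exact_mod_cast hD
  -- For r < δ the threshold is negative and the event is empty.
  rcases lt_or_ge r δ with h | h
  · have : {ω | √((D : ℝ)⁻¹ * ∑ i, Z i ω) ≤ r - δ} = ∅ := by
      refine Set.eq_empty_of_forall_notMem fun ω hω => ?_
      have := (Real.sqrt_nonneg _).trans hω
      linarith
    rw [this, measureReal_empty]
    exact (Real.exp_pos _).le
  have hr0 : 0 < r := hδ.trans_le h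
  -- With sr = δ/16 and sδ ≤ sr, the exponent per variable is at most -δ²/8 + δ²/16 + δ²/32 =
  -- -δ²/32.
  set s := δ / (16 * r) with hs
  have hs0 : 0 ≤ s := by positivity
  have hs8 : s ≤ 1 / 8 := by
    rw [hs, div_le_div_iff₀ (by positivity) (by norm_num)]
    linarith
  have hsr : s * r = δ / 16 := by rw [hs]; field_simp
  calc μ.real {ω | √((D : ℝ)⁻¹ * ∑ i, Z i ω) ≤ r - δ}
      ≤ μ.real {ω | (∑ i, Z i) ω ≤ D * (r - δ) ^ 2} := by
        refine measureReal_mono fun ω hω => ?_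
        simp only [Set.mem_ofPred_eq, Finset.sum_apply] at hω ⊢
        have := (Real.sqrt_le_left (by linarith)).1 hω
        rwa [← div_eq_inv_mul, div_le_iff₀' hD'] at this
    _ ≤ Real.exp (-(-s) * (D * (r - δ) ^ 2)) * mgf (∑ i, Z i) μ (-s) :=
        measure_le_le_exp_mul_mgf _ (by linarith)
          (integrable_exp_mul_sum_of_mem_Icc_zero_eight hZ h0 h8 (-s))
    _ ≤ Real.exp (-(-s) * (D * (r - δ) ^ 2)) * Real.exp (D * (r ^ 2 * (-s + 8 * (-s) ^ 2))) := by
        gcongr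
        refine mgf_sum_le_of_mem_Icc_zero_eight hind hZ h0 h8 hm ?_
        rwa [abs_neg, abs_of_nonneg hs0]
    _ ≤ _ := by
        rw [← Real.exp_add, Real.exp_le_exp]
        have : s * (r - δ) ^ 2 + r ^ 2 * (-s + 8 * (-s) ^ 2) ≤ -(δ ^ 2 / 32) := by
          have h1 : s * (r - δ) ^ 2 + r ^ 2 * (-s + 8 * (-s) ^ 2) =
              -2 * (s * r) * δ + s * δ * δ + 8 * (s * r) ^ 2 := by ring
          have h2 : s * δ ≤ s * r := by gcongr
          rw [hsr] at h1 h2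
          rw [h1]
          nlinarith
        nlinarith

end Concentration

/-! ### Transfer of the draw to ℝ^d and its independence structure. -/

lemma measurable_stateActionVec {p q : ℕ} {S : Set (EuclideanSpace ℝ (Fin p))}
    {A : Set (EuclideanSpace ℝ (Fin q))} :
    Measurable (stateActionVec : S × A → EuclideanSpace ℝ (Fin (p + q))) := by
  refine (PiLp.continuous_toLp 2 _).measurable.comp (measurable_pi_iff.2 fun i => ?_)
  refine Fin.addCases (fun i => ?_) (fun j => ?_) i
  · simp only [Fin.append_left]
    fun_prop
  · simp only [Fin.append_right]
    fun_prop

namespace IsDraw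

variable {Ω : Type*} [MeasurableSpace Ω] {μ : Measure Ω} {d D n : ℕ} {σ : ℝ}

/-- Composing the samples with `f` only shrinks their σ-algebras. This reduces the problem from
state-action pairs to two probability measures on ℝ^d. -/
lemma comp {𝓩 : Type*} [MeasurableSpace 𝓩] {ρ₁ ρ₂ : Measure 𝓩}
    {w : Fin D → Ω → EuclideanSpace ℝ (Fin d)} {b : Fin D → Ω → ℝ} {x y : Fin n → Ω → 𝓩}
    (h : IsDraw μ σ ρ₁ ρ₂ w b x y) {𝓨 : Type*} [MeasurableSpace 𝓨] {f : 𝓩 → 𝓨}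
    (hf : Measurable f) :
    IsDraw μ σ (ρ₁.map f) (ρ₂.map f) w b (fun j => f ∘ x j) (fun j => f ∘ y j) where
  measurable_w := h.measurable_w
  measurable_b := h.measurable_b
  measurable_x j := hf.comp (h.measurable_x j)
  measurable_y j := hf.comp (h.measurable_y j)
  law_w := h.law_w
  law_b := h.law_b
  law_x j := by rw [← h.law_x j, Measure.map_map hf (h.measurable_x j)]
  law_y j := by rw [← h.law_y j, Measure.map_map hf (h.measurable_y j)]
  indep := by
    have hle : ∀ g : Ω → 𝓩, MeasurableSpace.comap (f ∘ g) inferInstance ≤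
        MeasurableSpace.comap g inferInstance := fun g => by
      rw [← MeasurableSpace.comap_comp]
      exact MeasurableSpace.comap_mono hf.comap_le
    rw [iIndep_iff]
    intro s t ht
    refine (iIndep_iff _ _).1 h.indep s fun i hi => ?_
    have := ht i hi
    rcases i with (i | i) | (i | i)
    · exact this
    · exact this
    · exact hle _ _ this
    · exact hle _ _ this

variable {P Q : Measure (EuclideanSpace ℝ (Fin d))}
    {w : Fin D → Ω → EuclideanSpace ℝ (Fin d)} {b : Fin D → Ω → ℝ}
    {x y : Fin n → Ω → EuclideanSpace ℝ (Fin d)}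

lemma iIndepFun_features (h : IsDraw μ σ P Q w b x y) :
    iIndepFun (fun i ω => (w i ω, b i ω)) μ :=
  (h.indep.precomp Sum.inl_injective).iIndepFun_prodMk h.measurable_w h.measurable_b

lemma iIndepFun_samples (h : IsDraw μ σ P Q w b x y) :
    iIndepFun (Sum.elim x y) μ := by
  rw [iIndepFun_iff_iIndep]
  convert h.indep.precomp Sum.inr_injective using 1
  ext1 (i | i) <;> rfl

lemma map_feature [IsProbabilityMeasure μ] (h : IsDraw μ σ P Q w b x y) (i : Fin D) :
    μ.map (fun ω => (w i ω, b i ω)) = featureLaw d σ := by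
  have hi : IndepFun (w i) (b i) μ :=
    h.indep.indep (i := Sum.inl (Sum.inl i)) (j := Sum.inl (Sum.inr i)) (by simp)
  rw [(indepFun_iff_map_prod_eq_prod_map_map (h.measurable_w i).aemeasurable
    (h.measurable_b i).aemeasurable).1 hi, h.law_w, h.law_b, featureLaw]

lemma measurable_samples (h : IsDraw μ σ P Q w b x y) (k : Fin n ⊕ Fin n) :
    Measurable (Sum.elim x y k) := by
  rcases k with j | j
  · exact h.measurable_x j
  · exact h.measurable_y j

/-- Disjoint blocks of an independent family generate independent σ-algebras. One feature against
all samples is enough, since the Jensen step treats features one at a time. -/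
lemma indepFun_feature_samples (h : IsDraw μ σ P Q w b x y) (i : Fin D) :
    IndepFun (fun ω => (w i ω, b i ω)) (fun ω k => Sum.elim x y k ω) μ := by
  have hle : ∀ k, Sum.elim
      (Sum.elim (fun i => MeasurableSpace.comap (w i) inferInstance)
        (fun i => MeasurableSpace.comap (b i) inferInstance))
      (Sum.elim (fun j => MeasurableSpace.comap (x j) inferInstance)
        (fun j => MeasurableSpace.comap (y j) inferInstance)) k ≤ ‹MeasurableSpace Ω› := by
    rintro ((i | i) | (j | j))
    · exact (h.measurable_w i).comap_le
    · exact (h.measurable_b i).comap_le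
    · exact (h.measurable_x j).comap_le
    · exact (h.measurable_y j).comap_le
  have := indep_iSup_of_disjoint hle h.indep
    (S := Set.range Sum.inl) (T := Set.range Sum.inr) Set.isCompl_range_inl_range_inr.disjoint
  refine indep_of_indep_of_le_left (indep_of_indep_of_le_right this ?_) ?_
  · rw [← measurable_iff_comap_le]
    refine @measurable_pi_lambda _ _ _ (_) _ _ fun k => ?_
    rw [measurable_iff_comap_le]
    refine le_trans ?_ (le_iSup₂ (Sum.inr k) (Set.mem_range_self k))
    rcases k with j | j <;> exact le_rfl
  · rw [← measurable_iff_comap_le]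
    refine @Measurable.prodMk _ _ _ _ _ (_) _ _ ?_ ?_
    · rw [measurable_iff_comap_le]
      exact le_iSup₂_of_le (Sum.inl (Sum.inl i)) (Set.mem_range_self _) le_rfl
    · rw [measurable_iff_comap_le]
      exact le_iSup₂_of_le (Sum.inl (Sum.inr i)) (Set.mem_range_self _) le_rfl

end IsDraw

/-! ### Sampling error. -/

/-- The gap between two samples seen through a single random Fourier feature. -/
noncomputable def sampleGap {d n : ℕ} (x y : Fin n → EuclideanSpace ℝ (Fin d))
    (θ : EuclideanSpace ℝ (Fin d) × ℝ) : ℝ :=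
  √2 * ((n : ℝ)⁻¹ * ∑ j, Real.cos (inner ℝ θ.1 (x j) + θ.2) -
    (n : ℝ)⁻¹ * ∑ j, Real.cos (inner ℝ θ.1 (y j) + θ.2))

lemma embedding_sub_embedding_apply {d D n : ℕ} (w : Fin D → EuclideanSpace ℝ (Fin d))
    (b : Fin D → ℝ) (x y : Fin n → EuclideanSpace ℝ (Fin d)) (i : Fin D) :
    (embedding w b x - embedding w b y) i = √((D : ℝ)⁻¹) * sampleGap x y (w i, b i) := by
  simp only [embedding, fourierFeatures, sampleGap, PiLp.sub_apply, PiLp.smul_apply,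
    WithLp.ofLp_sum, Finset.sum_apply, smul_eq_mul, ← Finset.mul_sum, div_eq_mul_inv,
    Real.sqrt_mul zero_le_two, one_mul]
  ring

section

variable {Ω : Type*} [MeasurableSpace Ω] {μ : Measure Ω} [IsProbabilityMeasure μ] {d D n : ℕ}
  {σ : ℝ} {P Q : Measure (EuclideanSpace ℝ (Fin d))}
  {w : Fin D → Ω → EuclideanSpace ℝ (Fin d)} {b : Fin D → Ω → ℝ}
  {x y : Fin n → Ω → EuclideanSpace ℝ (Fin d)}

/-- Each centred cosine ranges over an interval of length 2, so has proxy 1 by Hoeffding's lemma.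
The 2n independent terms add to 2n, and the scaling (√2/n)² turns this into 4/n. -/
lemma hasSubgaussianMGF_sampleGap_sub (hn : 0 < n) (h : IsDraw μ σ P Q w b x y)
    (θ : EuclideanSpace ℝ (Fin d) × ℝ) :
    HasSubgaussianMGF (fun ω => sampleGap (x · ω) (y · ω) θ - featureGap P Q θ) (4 / n) μ := by
  have hn' : (n : ℝ) ≠ 0 := by exact_mod_cast hn.ne'
  let c : EuclideanSpace ℝ (Fin d) → ℝ := fun z => Real.cos (inner ℝ θ.1 z + θ.2)
  have hc : Measurable c := by fun_prop
  have key : ∀ (z : Ω → EuclideanSpace ℝ (Fin d)) (R : Measure (EuclideanSpace ℝ (Fin d))),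
      Measurable z → μ.map z = R →
      HasSubgaussianMGF (fun ω => c (z ω) - meanFeature R θ) 1 μ := by
    intro z R hz hR
    have := hasSubgaussianMGF_of_mem_Icc (μ := μ) (X := fun ω => c (z ω)) (a := -1) (b := 1)
      (hc.comp hz).aemeasurable (ae_of_all _ fun ω => Real.cos_mem_Icc _)
    have h1 : (‖(1 : ℝ) - -1‖₊ / 2) ^ 2 = 1 := by
      rw [show (1 : ℝ) - -1 = 2 by norm_num]
      ext
      simp
    rw [h1] at this
    rwa [meanFeature, ← hR, integral_map hz.aemeasurable hc.aestronglyMeasurable]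
  let g : Fin n ⊕ Fin n → EuclideanSpace ℝ (Fin d) → ℝ :=
    Sum.elim (fun _ z => c z - meanFeature P θ) (fun _ z => -(c z - meanFeature Q θ))
  have hg : ∀ k, Measurable (g k) := by
    rintro (j | j)
    · exact hc.sub_const _
    · exact (hc.sub_const _).neg
  have hsum := HasSubgaussianMGF.sum_of_iIndepFun (c := fun _ => 1) (s := Finset.univ)
    (h.iIndepFun_samples.comp g hg) (by
      rintro (j | j) -
      · exact key _ _ (h.measurable_x j) (h.law_x j)
      · exact (key _ _ (h.measurable_y j) (h.law_y j)).neg)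
  have hfin := hsum.const_mul (√2 * (n : ℝ)⁻¹)
  convert hfin using 1
  · ext ω
    simp only [Fintype.sum_sum_type, Function.comp_apply, g, Sum.elim_inl, Sum.elim_inr,
      Finset.sum_sub_distrib, Finset.sum_neg_distrib, Finset.sum_const, Finset.card_univ,
      Fintype.card_fin, nsmul_eq_mul, sampleGap, featureGap, c]
    field_simp
    ring
  · ext
    change _ = (√2 * (n : ℝ)⁻¹) ^ 2 * ((∑ _k : Fin n ⊕ Fin n, (1 : NNReal) : NNReal) : ℝ)
    rw [mul_pow, Real.sq_sqrt zero_le_two]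
    simp only [Finset.sum_const, Finset.card_univ, Fintype.card_sum, Fintype.card_fin,
      nsmul_eq_mul]
    push_cast
    field_simp
    norm_num

lemma measurable_sampleGap : Measurable
    fun q : (EuclideanSpace ℝ (Fin d) × ℝ) × (Fin n ⊕ Fin n → EuclideanSpace ℝ (Fin d)) =>
      sampleGap (fun j => q.2 (Sum.inl j)) (fun j => q.2 (Sum.inr j)) q.1 := by
  unfold sampleGap
  fun_prop

variable [IsProbabilityMeasure P] [IsProbabilityMeasure Q]

/-- Independence allows the feature to be frozen and integrated last. The coefficient n/16 times the
proxy 4/n is exactly the admissible 1/4. -/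
lemma lintegral_exp_sampleGap_sub_sq_le (hn : 0 < n) (h : IsDraw μ σ P Q w b x y) (i : Fin D) :
    ∫⁻ ω, ENNReal.ofReal (Real.exp (n / 16 * (sampleGap (x · ω) (y · ω) (w i ω, b i ω) -
      featureGap P Q (w i ω, b i ω)) ^ 2)) ∂μ ≤ 2 := by
  have hn' : (n : ℝ) ≠ 0 := by exact_mod_cast hn.ne'
  let H : (EuclideanSpace ℝ (Fin d) × ℝ) × (Fin n ⊕ Fin n → EuclideanSpace ℝ (Fin d)) → ENNReal :=
    fun q => ENNReal.ofReal (Real.exp (n / 16 * (sampleGap (fun j => q.2 (Sum.inl j))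
      (fun j => q.2 (Sum.inr j)) q.1 - featureGap P Q q.1) ^ 2))
  have hH : Measurable H := by
    have h1 := measurable_sampleGap (d := d) (n := n)
    have h2 : Measurable fun q : (EuclideanSpace ℝ (Fin d) × ℝ) ×
        (Fin n ⊕ Fin n → EuclideanSpace ℝ (Fin d)) => featureGap P Q q.1 :=
      (measurable_featureGap P Q).comp measurable_fst
    exact (((h1.sub h2).pow_const 2).const_mul _).exp.ennreal_ofReal
  have hθ : Measurable fun ω => (w i ω, b i ω) := (h.measurable_w i).prodMk (h.measurable_b i)
  have hz : Measurable fun ω k => Sum.elim x y k ω := measurable_pi_lambda _ h.measurable_samples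
  calc _ = ∫⁻ ω, H ((w i ω, b i ω), fun k => Sum.elim x y k ω) ∂μ := rfl
    _ = ∫⁻ θ, ∫⁻ ω, H (θ, fun k => Sum.elim x y k ω) ∂μ ∂(featureLaw d σ) := by
        rw [← lintegral_map hH (hθ.prodMk hz), (indepFun_iff_map_prod_eq_prod_map_map
          hθ.aemeasurable hz.aemeasurable).1 (h.indepFun_feature_samples i), h.map_feature,
          lintegral_prod _ hH.aemeasurable]
        congr with θ
        rw [lintegral_map (by fun_prop) hz]
    _ ≤ ∫⁻ θ, 2 ∂(featureLaw d σ) := by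
        refine lintegral_mono fun θ => ?_
        refine (hasSubgaussianMGF_sampleGap_sub hn h θ).lintegral_exp_sq_le (by positivity) ?_
        push_cast
        field_simp
        norm_num
    _ = 2 := by simp

/-! ### Combination of the two errors. -/

lemma measureReal_norm_embedding_sub_MMD_ge_le (hD : 0 < D) (hn : 0 < n)
    (h : IsDraw μ σ P Q w b x y) {ε : ℝ} (hε : 0 < ε) :
    μ.real {ω | 3 / 4 * ε ≤ |‖embedding (w · ω) (b · ω) (x · ω) -
        embedding (w · ω) (b · ω) (y · ω)‖ - MMD σ P Q|} ≤
      2 * Real.exp (-(n * ε ^ 2 / 256)) + 2 * Real.exp (-(D * ε ^ 2 / 128)) := by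
  have hD' : (0 : ℝ) < D := by exact_mod_cast hD
  have hθ : ∀ i, Measurable fun ω => (w i ω, b i ω) := fun i =>
    (h.measurable_w i).prodMk (h.measurable_b i)
  have hz : Measurable fun ω k => Sum.elim x y k ω := measurable_pi_lambda _ h.measurable_samples
  let Z : Fin D → Ω → ℝ := fun i ω => featureGap P Q (w i ω, b i ω) ^ 2
  let G : Fin D → Ω → ℝ := fun i ω => sampleGap (x · ω) (y · ω) (w i ω, b i ω) -
    featureGap P Q (w i ω, b i ω)
  have hF2 : Measurable fun θ => featureGap P Q θ ^ 2 := (measurable_featureGap P Q).pow_const 2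
  have hZ : ∀ i, Measurable (Z i) := fun i => hF2.comp (hθ i)
  have hG : ∀ i, Measurable (G i) := fun i =>
    (measurable_sampleGap.comp ((hθ i).prodMk hz)).sub ((measurable_featureGap P Q).comp (hθ i))
  have hind : iIndepFun Z μ := h.iIndepFun_features.comp (fun _ θ => featureGap P Q θ ^ 2)
    fun _ => hF2
  have h0 : ∀ i ω, 0 ≤ Z i ω := fun i ω => sq_nonneg _
  have h8 : ∀ i ω, Z i ω ≤ 8 := fun i ω => featureGap_sq_le P Q _
  have hm : ∀ i, ∫ ω, Z i ω ∂μ = MMD σ P Q ^ 2 := fun i => by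
    rw [MMD_sq, ← h.map_feature i, integral_map (hθ i).aemeasurable hF2.aestronglyMeasurable]
  have hup : μ.real {ω | MMD σ P Q + ε / 2 ≤ √((D : ℝ)⁻¹ * ∑ i, Z i ω)} ≤ _ :=
    measureReal_sqrt_average_ge_le hD hind hZ h0 h8
    (norm_nonneg _ : 0 ≤ MMD σ P Q) hm (half_pos hε)
  have hlow := measureReal_sqrt_average_le_le hD hind hZ h0 h8 hm (half_pos hε)
  have hsam := measureReal_average_sq_ge_le (μ := μ) (G := G) (t := (ε / 4) ^ 2) hD hG
    (lintegral_exp_sampleGap_sub_sq_le hn h) (by positivity)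
  -- The budget 3ε/4 is split into ε/4 for sampling, ‖U - V‖, and ε/2 for the features, |‖V‖ - MMD|.
  have hsub : {ω | 3 / 4 * ε ≤ |‖embedding (w · ω) (b · ω) (x · ω) -
        embedding (w · ω) (b · ω) (y · ω)‖ - MMD σ P Q|} ⊆
      {ω | (ε / 4) ^ 2 ≤ (D : ℝ)⁻¹ * ∑ i, G i ω ^ 2} ∪
      ({ω | MMD σ P Q + ε / 2 ≤ √((D : ℝ)⁻¹ * ∑ i, Z i ω)} ∪
       {ω | √((D : ℝ)⁻¹ * ∑ i, Z i ω) ≤ MMD σ P Q - ε / 2}) := by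
    intro ω hω
    by_contra hcon
    simp only [Set.mem_union, Set.mem_ofPred_eq, not_or, not_le] at hω hcon
    obtain ⟨hc1, hc2, hc3⟩ := hcon
    set U := embedding (w · ω) (b · ω) (x · ω) - embedding (w · ω) (b · ω) (y · ω) with hU
    let V : EuclideanSpace ℝ (Fin D) :=
      WithLp.toLp 2 fun i => √((D : ℝ)⁻¹) * featureGap P Q (w i ω, b i ω)
    have hV : ‖V‖ = √((D : ℝ)⁻¹ * ∑ i, Z i ω) := by
      rw [EuclideanSpace.norm_eq, Finset.mul_sum]
      congr 1
      refine Finset.sum_congr rfl fun i _ => ?_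
      rw [Real.norm_eq_abs, sq_abs, mul_pow, Real.sq_sqrt (inv_nonneg.2 hD'.le)]
    have hUV : ‖U - V‖ ^ 2 = (D : ℝ)⁻¹ * ∑ i, G i ω ^ 2 := by
      rw [EuclideanSpace.real_norm_sq_eq, Finset.mul_sum]
      refine Finset.sum_congr rfl fun i _ => ?_
      rw [PiLp.sub_apply, hU, embedding_sub_embedding_apply, ← mul_sub, mul_pow,
        Real.sq_sqrt (inv_nonneg.2 hD'.le)]
    rw [← hUV] at hc1
    rw [← hV] at hc2 hc3
    have h1 := lt_of_pow_lt_pow_left₀ 2 (by positivity) hc1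
    have h2 := abs_norm_sub_norm_le U V
    have h3 : |‖V‖ - MMD σ P Q| < ε / 2 := abs_lt.2 ⟨by linarith, by linarith⟩
    have h4 := abs_sub_le ‖U‖ ‖V‖ (MMD σ P Q)
    linarith
  refine (measureReal_mono hsub).trans ((measureReal_union_le _ _).trans ?_)
  have hu := measureReal_union_le (μ := μ) {ω | MMD σ P Q + ε / 2 ≤ √((D : ℝ)⁻¹ * ∑ i, Z i ω)}
    {ω | √((D : ℝ)⁻¹ * ∑ i, Z i ω) ≤ MMD σ P Q - ε / 2}
  rw [show (n : ℝ) * ε ^ 2 / 256 = n / 16 * (ε / 4) ^ 2 by ring,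
    show (D : ℝ) * ε ^ 2 / 128 = D * (ε / 2) ^ 2 / 32 by ring]
  linarith

end

/-! ### Crude bounds and the final constants. -/

lemma norm_embedding_le {d D n : ℕ} (hD : 0 < D) (hn : 0 < n)
    (w : Fin D → EuclideanSpace ℝ (Fin d))
    (b : Fin D → ℝ) (x : Fin n → EuclideanSpace ℝ (Fin d)) : ‖embedding w b x‖ ≤ 2 := by
  have hD' : (0 : ℝ) < D := by exact_mod_cast hD
  have hn' : (0 : ℝ) < n := by exact_mod_cast hn
  have h1 : ∀ z, ‖fourierFeatures w b z‖ ≤ 2 := by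
    intro z
    rw [EuclideanSpace.norm_eq, Real.sqrt_le_left zero_le_two]
    calc ∑ i, ‖fourierFeatures w b z i‖ ^ 2 ≤ ∑ _i : Fin D, 2 / (D : ℝ) := by
          refine Finset.sum_le_sum fun i _ => ?_
          rw [fourierFeatures, Real.norm_eq_abs, sq_abs, mul_pow, Real.sq_sqrt (by positivity)]
          exact mul_le_of_le_one_right (by positivity) (Real.cos_sq_le_one _)
      _ = 2 := by
          simp
          field_simp
      _ ≤ 2 ^ 2 := by norm_num
  rw [embedding, norm_smul, Real.norm_eq_abs, abs_of_pos (by positivity), one_div,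
    inv_mul_le_iff₀ hn']
  calc ‖∑ j, fourierFeatures w b (x j)‖ ≤ ∑ _j : Fin n, (2 : ℝ) :=
        norm_sum_le_of_le _ fun j _ => h1 _
    _ = _ := by simp

lemma MMD_le {d : ℕ} (σ : ℝ) (P Q : Measure (EuclideanSpace ℝ (Fin d)))
    [IsProbabilityMeasure P] [IsProbabilityMeasure Q] : MMD σ P Q ≤ 2 := by
  have h : ∀ (ρ : Measure (EuclideanSpace ℝ (Fin d))) [IsProbabilityMeasure ρ],
      ‖∫ x, gaussianFeature σ x ∂ρ‖ ≤ 1 := fun ρ _ => by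
    simpa using norm_integral_le_of_norm_le_const (μ := ρ)
      (ae_of_all _ fun x => (norm_gaussianFeature σ x).le)
  exact (norm_sub_le _ _).trans (by linarith [h P, h Q])

end AutoQD

theorem theorem1 :
    ∃ c : ℝ, 0 < c ∧ ∃ C : ℝ, 0 < C ∧
      ∀ (p q : ℕ) (S : Set (EuclideanSpace ℝ (Fin p))) (A : Set (EuclideanSpace ℝ (Fin q)))
        (M : AutoQD.MDP S A) (π₁ π₂ : Kernel S A) [IsMarkovKernel π₁] [IsMarkovKernel π₂]
        (σ : ℝ) (_hσ : 0 < σ) (D n : ℕ) (_hD : 0 < D) (_hn : 0 < n)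
        (Ω : Type*) [MeasurableSpace Ω] (μ : Measure Ω) [IsProbabilityMeasure μ]
        (w : Fin D → Ω → EuclideanSpace ℝ (Fin (p + q))) (b : Fin D → Ω → ℝ)
        (x y : Fin n → Ω → S × A)
        (_hdraw : AutoQD.IsDraw μ σ (M.occupancy π₁) (M.occupancy π₂) w b x y)
        (ε : ℝ) (_hε : 0 < ε),
        μ.real {ω | 3 / 4 * ε ≤
            |‖AutoQD.embedding (fun i => w i ω) (fun i => b i ω)
                  (fun j => AutoQD.stateActionVec (x j ω))
                - AutoQD.embedding (fun i => w i ω) (fun i => b i ω)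
                  (fun j => AutoQD.stateActionVec (y j ω))‖
              - AutoQD.MMD σ ((M.occupancy π₁).map AutoQD.stateActionVec)
                  ((M.occupancy π₂).map AutoQD.stateActionVec)|}
          ≤ 2 * Real.exp (-(n * c * ε ^ 2))
            + C * (1 / ε ^ 2 * Real.exp (-(D * ε ^ 2) / (64 * (((p + q : ℕ) : ℝ) + 2))))
            + 6 * Real.exp (-(n * ε ^ 2) / 8) := by
  -- 1/256 = (1/16)(1/4)² is the sampling rate; 128 = 2·8² makes C/ε² at least 2 up to ε = 8.
  refine ⟨1 / 256, by norm_num, 128, by norm_num, ?_⟩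
  intro p q S A M π₁ π₂ _ _ σ _ D n hD hn Ω _ μ _ w b x y hdraw ε hε
  have hvec := AutoQD.measurable_stateActionVec (S := S) (A := A)
  have : IsProbabilityMeasure ((M.occupancy π₁).map AutoQD.stateActionVec) :=
    Measure.isProbabilityMeasure_map hvec.aemeasurable
  have : IsProbabilityMeasure ((M.occupancy π₂).map AutoQD.stateActionVec) :=
    Measure.isProbabilityMeasure_map hvec.aemeasurable
  have hdim : (0 : ℝ) ≤ ((p + q : ℕ) : ℝ) := Nat.cast_nonneg _
  -- For ε > 8 the event is empty: the embedding distance and the MMD both lie in [0, 4], while 3ε/4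
  -- > 6.
  rcases lt_or_ge (8 : ℝ) ε with h8 | h8
  · refine le_trans (le_of_eq ?_) (by positivity : (0 : ℝ) ≤ _)
    convert measureReal_empty (μ := μ)
    refine Set.eq_empty_of_forall_notMem fun ω hω => ?_
    simp only [Set.mem_ofPred_eq] at hω
    have hx := AutoQD.norm_embedding_le hD hn (fun i => w i ω) (fun i => b i ω)
      (fun j => AutoQD.stateActionVec (x j ω))
    have hy := AutoQD.norm_embedding_le hD hn (fun i => w i ω) (fun i => b i ω)
      (fun j => AutoQD.stateActionVec (y j ω))
    have hM := AutoQD.MMD_le σ ((M.occupancy π₁).map AutoQD.stateActionVec)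
      ((M.occupancy π₂).map AutoQD.stateActionVec)
    have hM0 : 0 ≤ AutoQD.MMD σ ((M.occupancy π₁).map AutoQD.stateActionVec)
      ((M.occupancy π₂).map AutoQD.stateActionVec) := norm_nonneg _
    have hs := norm_sub_le (AutoQD.embedding (fun i => w i ω) (fun i => b i ω)
      (fun j => AutoQD.stateActionVec (x j ω))) (AutoQD.embedding (fun i => w i ω) (fun i => b i ω)
      (fun j => AutoQD.stateActionVec (y j ω)))
    have hs0 := norm_nonneg (AutoQD.embedding (fun i => w i ω) (fun i => b i ω)
      (fun j => AutoQD.stateActionVec (x j ω)) - AutoQD.embedding (fun i => w i ω)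
      (fun i => b i ω) (fun j => AutoQD.stateActionVec (y j ω)))
    have := hω.trans (abs_le.2 ⟨by linarith, by linarith⟩ : _ ≤ (4 : ℝ))
    linarith
  · have hmain := AutoQD.measureReal_norm_embedding_sub_MMD_ge_le hD hn (hdraw.comp hvec) hε
    refine hmain.trans ?_
    have h1 : (2 : ℝ) ≤ 128 * (1 / ε ^ 2) := by
      rw [mul_one_div, le_div_iff₀ (by positivity)]
      nlinarith
    -- Since d ≥ 0, 64(d + 2) ≥ 128.
    have h2 : Real.exp (-(D * ε ^ 2 / 128)) ≤
        Real.exp (-(D * ε ^ 2) / (64 * (((p + q : ℕ) : ℝ) + 2))) := by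
      rw [neg_div, Real.exp_le_exp, neg_le_neg_iff]
      gcongr
      linarith
    have h3 : 2 * Real.exp (-(D * ε ^ 2 / 128)) ≤
        128 * (1 / ε ^ 2 * Real.exp (-(D * ε ^ 2) / (64 * (((p + q : ℕ) : ℝ) + 2)))) := by
      rw [← mul_assoc]
      exact mul_le_mul h1 h2 (Real.exp_pos _).le (by positivity)
    have h4 : (0 : ℝ) ≤ 6 * Real.exp (-(n * ε ^ 2) / 8) := by positivity
    rw [show (n : ℝ) * (1 / 256) * ε ^ 2 = n * ε ^ 2 / 256 by ring]
    linarith
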